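/- **Setting.** Let $\Delta_1,\dots,\Delta_m\subseteq[n]$ with $\Delta_1\cup\dots\cup\Delta_m=[n]$, and write $x_{\Delta_i}=(x_j)_{j\in\Delta_i}$. Let $f_i\in\mathbb R[x_{\Delta_i}]$, let $G_i$ be a symmetric matrix polynomial in $x_{\Delta_i}$, let $K_{\Delta_i}=\{u\in\mathbb R^{\Delta_i}:G_i(u)\succeq 0\}$, and consider $$f_{\min}=\min_{x\in\mathbb R^n}\ f(x)=f_1(x_{\Delta_1})+\dots+f_m(x_{\Delta_m})\quad\text{s.t. } G_i(x_{\Delta_i})\succeq 0,\ i=1,\dots,m. \tag{P}$$ Put $d_i=\lceil\deg(G_i)/2\rceil$ (where $\deg G_i$ is the maximal degree of the entries) and $k_0=\max\{\lceil\deg(f)/2\rceil,d_1,\dots,d_m\}$. Let $\mathbb N^{\Delta_i}_{d}$ be the set of $\alpha\in\mathbb N^n$ with $|\alpha|\le d$ and $\alpha_j=0$ for $j\notin\Delta_i$, and $\mathbb U_k=\bigcup_i\mathbb N^{\Delta_i}_{2k}$. For $y\in\mathbb R^{\mathbb U_k}$ let $y_{\Delta_i}=(y_\alpha)_{\alpha\in\mathbb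 N^{\Delta_i}_{2k}}$, let $\mathscr L_{y}$ be the linear functional with $x^\alpha\mapsto y_\alpha$ for $\alpha\in\mathbb U_k$, let $\langle f,y\rangle=\mathscr L_y(f)$, let $M^{(s)}_{\Delta_i}[y_{\Delta_i}]=(y_{\alpha+\beta})_{\alpha,\beta\in\mathbb N^{\Delta_i}_s}$ for $s\le k$ (moment matrix), and let $L^{(k)}_{G_i}[y_{\Delta_i}]$ (localizing matrix) be the block matrix whose blocks are $\big(\mathscr L_y((G_i)_{ab}\,x^{\alpha+\beta})\big)_{\alpha,\beta\in\mathbb N^{\Delta_i}_{k-d_i}}$. For $k\ge k_0$ the sparse moment relaxation of order $k$ is $$f_k^{smo}=\inf_{y\in\mathbb R^{\mathbb U_k}}\ \langle f,y\rangle\quad\text{s.t. } L^{(k)}_{G_i}[y_{\Delta_i}]\succeq0,\ M^{(k)}_{\Delta_i}[y_{\Delta_i}]\succeq0\ (i=1,\dots,m),\ y_0=1,$$ and the sparse SOS relaxation is $f_k^{spa}=\sup\{\gamma\in\mathbb R: f-\gamma\in\sum_{i}\mathrm{QM}_{\Delta_i}[G_i]_{2k}\}$, where $\mathrm{QM}_{\Delta_i}[G_i]_{2k}$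 is the set of all $\sigma+\sum_{j=1}^s p_j^TG_ip_j$ with $\sigma\in\mathbb R[x_{\Delta_i}]$ a sum of squares of degree at most $2k$, $s\in\mathbb N$, and polynomial vectors $p_j$ in $x_{\Delta_i}$ with $2\deg(p_j)+\deg(G_i)\le 2k$. All optimal values are taken in $[-\infty,+\infty]$. **Theorem.** Let $y^*$ be a minimizer of the sparse moment relaxation of order $k$. Suppose there is an integer $t\in[k_0,k]$ such that $f_t^{smo}=f_k^{smo}$ and the flat truncation condition $$r_i:=\operatorname{rank}M^{(t)}_{\Delta_i}[y^*_{\Delta_i}]=\operatorname{rank}M^{(t-d_i)}_{\Delta_i}[y^*_{\Delta_i}],\qquad i=1,\dots,m,$$ holds. Call a set $\mathcal X_{\Delta_i}\subseteq K_{\Delta_i}$ of $r_i$ points $u^{(i,1)},\dots,u^{(i,r_i)}$ an atom set for $i$ if there are $\lambda_{i,1},\dots,\lambda_{i,r_i}>0$ with $\sum_j\lambda_{i,j}=1$ and $y^*_\alpha=\sum_j\lambda_{i,j}\,(u^{(i,j)})^\alpha$ for all $\alpha\in\mathbb N^{\Delta_i}_{2t}$. (o) For every $i$ such that $G_i$ is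 not constant, an atom set for $i$ exists. Let $\mathcal X_{\Delta_i}$ be an atom set for $i$, for every $i=1,\dots,m$. (i) If $x^*\in\mathbb R^n$ satisfies $x^*_{\Delta_i}\in\mathcal X_{\Delta_i}$ for all $i=1,\dots,m$, then $f_{\min}=f_k^{smo}$ and $x^*$ is a minimizer of (P). (ii) In (i), if in addition there is no duality gap, i.e. $f_k^{spa}=f_k^{smo}$, then $f_{\min}=f_k^{spa}$. -/

import Mathlib

noncomputable section

/-! ### Polynomials, degrees and truncated quadratic modules in the variables `σ` -/

/-- The set `ℕ^σ_d` of monomial powers in the variables `σ` of degree at most `d`. -/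
def monoPow (σ : Type) [Finite σ] (d : ℕ) : Finset (σ →₀ ℕ) :=
  (Finsupp.finite_of_degree_le (σ := σ) d).toFinset

/-- The degree of a polynomial vector: the maximal degree of its entries. -/
def vecDeg {σ : Type} {l : ℕ} (p : Fin l → MvPolynomial σ ℝ) : ℕ :=
  Finset.univ.sup fun a => (p a).totalDegree

/-- The degree of a matrix polynomial: the maximal degree of its entries. -/
def matDeg {σ : Type} {l : ℕ} (G : Matrix (Fin l) (Fin l) (MvPolynomial σ ℝ)) : ℕ :=
  Finset.univ.sup fun a => Finset.univ.sup fun b => (G a b).totalDegree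

/-- `⌈d / 2⌉` for a natural number `d`. -/
def ceilHalf (d : ℕ) : ℕ := (d + 1) / 2

/-- The truncation `QM[G]_{2k}` of the quadratic module generated by `G`: sums of an SOS polynomial
of degree at most `2k` and finitely many terms `pᵀ G p` with `2 deg p + deg G ≤ 2k`. -/
def truncQM {σ : Type} {l : ℕ} (G : Matrix (Fin l) (Fin l) (MvPolynomial σ ℝ)) (k : ℕ) :
    Set (MvPolynomial σ ℝ) :=
  {q | ∃ q₀ : MvPolynomial σ ℝ, IsSumSq q₀ ∧ q₀.totalDegree ≤ 2 * k ∧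
    ∃ (s : ℕ) (p : Fin s → Fin l → MvPolynomial σ ℝ),
      (∀ j, 2 * vecDeg (p j) + matDeg G ≤ 2 * k) ∧
      q = q₀ + ∑ j, p j ⬝ᵥ G.mulVec (p j)}

/-! ### Moment and localizing matrices

A multi-sequence is given as a function `z` on all exponents; a truncated one is extended by zero
(see `SparseMatPOP.sub`). The matrices below of order `k` only read entries of degree at most `2k`
(for the localizing matrix: as soon as `deg G ≤ 2k`). -/

/-- The Riesz functional `𝓛_z (∑ p_α x^α) = ∑ p_α z_α`. -/
def riesz {σ : Type} (z : (σ →₀ ℕ) → ℝ) (p : MvPolynomial σ ℝ) : ℝ :=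
  ∑ α ∈ p.support, p.coeff α * z α

/-- The moment matrix of order `k`, with entries `z_{α+β}` for `|α|, |β| ≤ k`. -/
def momentMatrix {σ : Type} [Finite σ] (z : (σ →₀ ℕ) → ℝ) (k : ℕ) :
    Matrix (monoPow σ k) (monoPow σ k) ℝ :=
  Matrix.of fun α β => z (α.1 + β.1)

/-- The localizing matrix of order `k` of the matrix polynomial `G`: the block matrix with blocks
`𝓛_z (G_{ab} · [x]_s [x]_sᵀ)`, where `s = ⌊k - deg G / 2⌋`. -/
def localizingMatrix {σ : Type} [Finite σ] {l : ℕ}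
    (G : Matrix (Fin l) (Fin l) (MvPolynomial σ ℝ)) (z : (σ →₀ ℕ) → ℝ) (k : ℕ) :
    Matrix (Fin l × monoPow σ ((2 * k - matDeg G) / 2))
      (Fin l × monoPow σ ((2 * k - matDeg G) / 2)) ℝ :=
  Matrix.of fun p q =>
    riesz z (G p.1 q.1 * (MvPolynomial.monomial p.2.1 1 * MvPolynomial.monomial q.2.1 1))

/-! ### The sparse matrix polynomial optimization problem -/

/-- The data of the problem: minimize `f₁(x_{Δ₁}) + ⋯ + f_m(x_{Δ_m})` over `x ∈ ℝⁿ` subject to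
`G_i(x_{Δ_i}) ⪰ 0`, where `Δ₁ ∪ ⋯ ∪ Δ_m = [n]` and the `G_i` are symmetric matrix polynomials. -/
structure SparseMatPOP (n m : ℕ) where
  Δ : Fin m → Finset (Fin n)
  cover : ∀ j, ∃ i, j ∈ Δ i
  f : (i : Fin m) → MvPolynomial (Δ i) ℝ
  len : Fin m → ℕ
  G : (i : Fin m) → Matrix (Fin (len i)) (Fin (len i)) (MvPolynomial (Δ i) ℝ)
  symm : ∀ i, (G i).IsSymm

namespace SparseMatPOP

variable {n m : ℕ} (P : SparseMatPOP n m)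

/-- The subvector `x_{Δ_i}` of `x`. -/
def subvec (i : Fin m) (x : Fin n → ℝ) : P.Δ i → ℝ := fun j => x j.1

/-- A polynomial in `x_{Δ_i}`, seen as a polynomial in `x`. -/
def incl (i : Fin m) (p : MvPolynomial (P.Δ i) ℝ) : MvPolynomial (Fin n) ℝ :=
  MvPolynomial.rename Subtype.val p

/-- The objective `f = f₁ + ⋯ + f_m` as an element of `ℝ[x]`. -/
def obj : MvPolynomial (Fin n) ℝ := ∑ i, P.incl i (P.f i)

/-- The set `K_{Δ_i} = {u : G_i(u) ⪰ 0}`. -/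
def KΔ (i : Fin m) : Set (P.Δ i → ℝ) :=
  {u | ((P.G i).map (MvPolynomial.eval u)).PosSemidef}

/-- The feasible set `K`. -/
def K : Set (Fin n → ℝ) := {x | ∀ i, P.subvec i x ∈ P.KΔ i}

/-- The optimal value `f_min`. -/
def fmin : EReal := sInf ((fun x => ((MvPolynomial.eval x P.obj : ℝ) : EReal)) '' P.K)

/-- `x` is a (global) minimizer of the problem. -/
def IsMinimizer (x : Fin n → ℝ) : Prop :=
  x ∈ P.K ∧ ∀ x' ∈ P.K, MvPolynomial.eval x P.obj ≤ MvPolynomial.eval x' P.obj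

/-- `d_i = ⌈deg(G_i) / 2⌉`. -/
def d (i : Fin m) : ℕ := ceilHalf (matDeg (P.G i))

/-- `k₀`, the maximum of `⌈deg(f) / 2⌉` and of all `⌈deg(G_i) / 2⌉`. -/
def k₀ : ℕ := max (ceilHalf P.obj.totalDegree) (Finset.univ.sup P.d)

/-! ### The sparse SOS relaxation -/

/-- The truncated sparse quadratic module `QM[G]_{spa,2k} = ∑ i, QM_{Δ_i}[G_i]_{2k}`. -/
def sparseQM (k : ℕ) : Set (MvPolynomial (Fin n) ℝ) :=
  {q | ∃ p : (i : Fin m) → MvPolynomial (P.Δ i) ℝ,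
    (∀ i, p i ∈ truncQM (P.G i) k) ∧ q = ∑ i, P.incl i (p i)}

/-- The optimal value `f_k^{spa}` of the sparse SOS relaxation of order `k`. -/
def fspa (k : ℕ) : EReal :=
  sSup ((fun γ : ℝ => (γ : EReal)) '' {γ : ℝ | P.obj - MvPolynomial.C γ ∈ P.sparseQM k})

/-! ### The sparse moment relaxation -/

/-- `𝕌_k = ⋃ i, ℕ^{Δ_i}_{2k}`, where `ℕ^{Δ_i}_{2k}` consists of the powers `α ∈ ℕⁿ` with `|α| ≤ 2k`
and `α_j = 0` for all `j ∉ Δ_i`. -/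
def U (k : ℕ) : Set (Fin n →₀ ℕ) :=
  {α | ∃ i, (∀ j, j ∉ P.Δ i → α j = 0) ∧ α.degree ≤ 2 * k}

/-- The space `ℝ^{𝕌_k}`. -/
abbrev TMS (k : ℕ) : Type := P.U k → ℝ

open Classical in
/-- The entry `y_α`, with value `0` if `α ∉ 𝕌_k`. -/
def entry {k : ℕ} (y : P.TMS k) (α : Fin n →₀ ℕ) : ℝ :=
  if h : α ∈ P.U k then y ⟨α, h⟩ else 0

/-- The subvector `y_{Δ_i}`, labelled by the powers of monomials in `x_{Δ_i}` (of degree at most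
`2k`; the other entries are `0`). -/
def sub {k : ℕ} (y : P.TMS k) (i : Fin m) : (P.Δ i →₀ ℕ) → ℝ :=
  fun α => P.entry y (α.mapDomain Subtype.val)

/-- `⟨f, y⟩ = ⟨f₁, y_{Δ₁}⟩ + ⋯ + ⟨f_m, y_{Δ_m}⟩`. If `deg f ≤ 2k` while some `f_i` have a larger
degree, then the terms of degree above `2k` cancel in `f`, and they do not contribute here. -/
def pairing {k : ℕ} (y : P.TMS k) : ℝ := ∑ i, riesz (P.sub y i) (P.f i)

/-- The feasible set of the sparse moment relaxation of order `k`. -/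
def momFeasible (k : ℕ) : Set (P.TMS k) :=
  {y | (∀ i, (localizingMatrix (P.G i) (P.sub y i) k).PosSemidef) ∧
    (∀ i, (momentMatrix (P.sub y i) k).PosSemidef) ∧ P.entry y 0 = 1}

/-- The optimal value `f_k^{smo}` of the sparse moment relaxation of order `k`. -/
def fsmo (k : ℕ) : EReal :=
  sInf ((fun y : P.TMS k => ((P.pairing y : ℝ) : EReal)) '' P.momFeasible k)

/-- `y` is a minimizer of the sparse moment relaxation of order `k`. -/
def IsMomMinimizer {k : ℕ} (y : P.TMS k) : Prop :=
  y ∈ P.momFeasible k ∧ ∀ y' ∈ P.momFeasible k, P.pairing y ≤ P.pairing y'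

/-- The flat truncation condition at `t`:
`rank M^{(t)}_{Δ_i}[y_{Δ_i}] = rank M^{(t - d_i)}_{Δ_i}[y_{Δ_i}]` for all `i`. -/
def FlatTruncation {k : ℕ} (y : P.TMS k) (t : ℕ) : Prop :=
  ∀ i, (momentMatrix (P.sub y i) t).rank = (momentMatrix (P.sub y i) (t - P.d i)).rank

/-- `X` is a support set `𝒳_{Δ_i}` at `t`: it consists of `r_i = rank M^{(t)}_{Δ_i}[y_{Δ_i}]` points
of `K_{Δ_i}`, and the truncation `y_{Δ_i}|_{2t}` is a convex combination with positive
coefficients of the vectors `[u]_{2t}`, `u ∈ X`. -/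
def IsAtomSet {k : ℕ} (y : P.TMS k) (t : ℕ) (i : Fin m) (X : Finset (P.Δ i → ℝ)) : Prop :=
  X.card = (momentMatrix (P.sub y i) t).rank ∧ (∀ u ∈ X, u ∈ P.KΔ i) ∧
    ∃ w : (P.Δ i → ℝ) → ℝ, (∀ u ∈ X, 0 < w u) ∧ ∑ u ∈ X, w u = 1 ∧
      ∀ α ∈ monoPow (P.Δ i) (2 * t), P.sub y i α = ∑ u ∈ X, w u * ∏ j, u j ^ α j

end SparseMatPOP

end

/-! Existence of atoms is the flat extension theorem on each block (`exists_atoms_of_flat`). A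
positive semidefinite moment matrix is a Gram matrix of vectors `a α`. Flatness says that the
vectors of degree at most `s = t - d_i` already span the whole space `H`, so multiplication by each
variable descends to `H`. These operators are symmetric and commute; their joint eigenvalues are the
atoms, and the squared norms of the components of the class of `1` are the weights. Each atom is
separated from the others by a polynomial of degree at most `s`, and testing the localizing matrix
with it gives `G_i(u) ⪰ 0` (`IsAtomicUpTo.posSemidef_eval`).

Optimality needs no measure on `ℝⁿ` that glues the block measures. Dirac sequences show that the
relaxation bounds `f` from below on `K`. Conversely, if every subvector of `x` is an atom, then `y -
ε [x]`, rescaled by `1 / (1 - ε)`, still has nonnegative weights in every block, hence is feasible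
at order `t`. Since `y` is optimal at order `t` too, its value cannot exceed that of the rescaled
sequence, and this forces `f(x) ≤ ⟨f, y⟩` (`eval_obj_le_pairing`). -/

noncomputable section

open MvPolynomial Matrix

/-! ### Riesz functional and matrices of atomic sequences -/

section Riesz

variable {σ : Type}

/-- The Riesz functional as a linear map. -/
def rieszLin (z : (σ →₀ ℕ) → ℝ) : MvPolynomial σ ℝ →ₗ[ℝ] ℝ :=
  (basisMonomials σ ℝ).constr ℝ z

theorem constr_basisMonomials_monomial {E : Type*} [AddCommGroup E] [Module ℝ E]
    (a : (σ →₀ ℕ) → E) (α : σ →₀ ℕ) (c : ℝ) :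
    (basisMonomials σ ℝ).constr ℝ a (monomial α c) = c • a α := by
  have h : (monomial α c : MvPolynomial σ ℝ) = c • basisMonomials σ ℝ α := by
    simp [smul_monomial]
  rw [h, map_smul, Module.Basis.constr_basis]

theorem rieszLin_monomial (z : (σ →₀ ℕ) → ℝ) (α : σ →₀ ℕ) (c : ℝ) :
    rieszLin z (monomial α c) = c * z α :=
  constr_basisMonomials_monomial z α c

theorem linearMap_apply_eq_sum {E : Type*} [AddCommGroup E] [Module ℝ E]
    (A : MvPolynomial σ ℝ →ₗ[ℝ] E) (p : MvPolynomial σ ℝ) :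
    A p = ∑ α ∈ p.support, p.coeff α • A (monomial α 1) := by
  conv_lhs => rw [← support_sum_monomial_coeff p]
  rw [map_sum]
  refine Finset.sum_congr rfl fun α _ => ?_
  rw [← map_smul, smul_monomial, smul_eq_mul, mul_one]

theorem riesz_eq_rieszLin (z : (σ →₀ ℕ) → ℝ) (p : MvPolynomial σ ℝ) :
    riesz z p = rieszLin z p := by
  rw [linearMap_apply_eq_sum]
  simp [riesz, rieszLin_monomial]

theorem degree_le_of_mem_support {p : MvPolynomial σ ℝ} {α : σ →₀ ℕ} (h : α ∈ p.support) :
    α.degree ≤ p.totalDegree := le_totalDegree h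

/-- The degree bound is essential: truncated sequences are controlled only up to a fixed degree, so
identities of functionals are checked on monomials below it. -/
theorem linearMap_congr {E : Type*} [AddCommGroup E] [Module ℝ E]
    {A B : MvPolynomial σ ℝ →ₗ[ℝ] E} {p : MvPolynomial σ ℝ} {N : ℕ} (hp : p.totalDegree ≤ N)
    (h : ∀ α : σ →₀ ℕ, α.degree ≤ N → A (monomial α 1) = B (monomial α 1)) : A p = B p := by
  rw [linearMap_apply_eq_sum A, linearMap_apply_eq_sum B]
  exact Finset.sum_congr rfl fun α hα => by
    rw [h α ((degree_le_of_mem_support hα).trans hp)]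

theorem totalDegree_monomial_one (α : σ →₀ ℕ) :
    (monomial α (1 : ℝ)).totalDegree = α.degree :=
  totalDegree_monomial α one_ne_zero

theorem mem_monoPow [Finite σ] {d : ℕ} {α : σ →₀ ℕ} : α ∈ monoPow σ d ↔ α.degree ≤ d := by
  simp [monoPow]

theorem totalDegree_le_matDeg {l : ℕ} (G : Matrix (Fin l) (Fin l) (MvPolynomial σ ℝ))
    (a b : Fin l) : (G a b).totalDegree ≤ matDeg G :=
  (Finset.le_sup (f := fun b => (G a b).totalDegree) (Finset.mem_univ b)).trans
    (Finset.le_sup (f := fun a => Finset.univ.sup fun b => (G a b).totalDegree)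
      (Finset.mem_univ a))

theorem totalDegree_localizing_le {l : ℕ} (G : Matrix (Fin l) (Fin l) (MvPolynomial σ ℝ))
    (a b : Fin l) {p q : MvPolynomial σ ℝ} {s N : ℕ} (hp : p.totalDegree ≤ s)
    (hq : q.totalDegree ≤ s) (hN : matDeg G + 2 * s ≤ N) :
    (G a b * (p * q)).totalDegree ≤ N := by
  have h1 := totalDegree_mul (G a b) (p * q)
  have h2 := totalDegree_mul p q
  have h3 := totalDegree_le_matDeg G a b
  omega

/-- `z` is, up to degree `N`, the moment sequence of `∑ u ∈ X, w u • δ_u`. -/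
def IsAtomicUpTo [Fintype σ] (z : (σ →₀ ℕ) → ℝ) (N : ℕ) (X : Finset (σ → ℝ)) (w : (σ → ℝ) → ℝ) :
    Prop :=
  ∀ α : σ →₀ ℕ, α.degree ≤ N → z α = ∑ u ∈ X, w u * ∏ j, u j ^ α j

variable [Fintype σ]

theorem eval_monomial_one (u : σ → ℝ) (α : σ →₀ ℕ) :
    eval u (monomial α 1) = ∏ j, u j ^ α j := by
  rw [eval_monomial, one_mul, Finsupp.prod_fintype _ _ fun _ => pow_zero _]

theorem IsAtomicUpTo.riesz_eq {z : (σ →₀ ℕ) → ℝ} {N : ℕ} {X : Finset (σ → ℝ)} {w : (σ → ℝ) → ℝ}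
    (h : IsAtomicUpTo z N X w) {p : MvPolynomial σ ℝ} (hp : p.totalDegree ≤ N) :
    riesz z p = ∑ u ∈ X, w u * eval u p := by
  have key := linearMap_congr (A := rieszLin z)
    (B := ∑ u ∈ X, w u • (aeval u : MvPolynomial σ ℝ →ₐ[ℝ] ℝ).toLinearMap) hp fun α hα => by
      have h1 : ∀ u : σ → ℝ, aeval u (monomial α (1 : ℝ)) = ∏ j, u j ^ α j := fun u => by
        rw [← eval_monomial_one]; rfl
      simp only [rieszLin_monomial, h α hα, LinearMap.sum_apply, LinearMap.smul_apply,
        AlgHom.toLinearMap_apply, h1, one_mul, smul_eq_mul]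
  rw [riesz_eq_rieszLin, key]
  simp only [LinearMap.sum_apply, LinearMap.smul_apply, AlgHom.toLinearMap_apply, smul_eq_mul]
  rfl

theorem IsAtomicUpTo.posSemidef_momentMatrix {z : (σ →₀ ℕ) → ℝ} {k : ℕ} {X : Finset (σ → ℝ)}
    {w : (σ → ℝ) → ℝ} (h : IsAtomicUpTo z (2 * k) X w) (hw : ∀ u ∈ X, 0 ≤ w u) :
    (momentMatrix z k).PosSemidef := by
  have e : momentMatrix z k = ∑ u ∈ X, w u •
      vecMulVec (fun α : monoPow σ k => ∏ j, u j ^ α.1 j)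
        (star fun α : monoPow σ k => ∏ j, u j ^ α.1 j) := by
    ext α β
    have h1 := mem_monoPow.1 α.2
    have h2 := mem_monoPow.1 β.2
    simp only [momentMatrix, of_apply, Matrix.sum_apply, Matrix.smul_apply, vecMulVec_apply,
      star_trivial, smul_eq_mul]
    rw [h _ (by rw [map_add]; omega)]
    simp [pow_add, Finset.prod_mul_distrib]
  rw [e]
  exact posSemidef_sum _ fun u hu => (posSemidef_vecMulVec_self_star _).smul (hw u hu)

theorem IsAtomicUpTo.posSemidef_localizingMatrix {l : ℕ}
    {G : Matrix (Fin l) (Fin l) (MvPolynomial σ ℝ)} {z : (σ →₀ ℕ) → ℝ} {k : ℕ}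
    (hG : matDeg G ≤ 2 * k) {X : Finset (σ → ℝ)} {w : (σ → ℝ) → ℝ}
    (h : IsAtomicUpTo z (2 * k) X w) (hw : ∀ u ∈ X, 0 ≤ w u)
    (hX : ∀ u ∈ X, (G.map (eval u)).PosSemidef) :
    (localizingMatrix G z k).PosSemidef := by
  -- An atom `u` contributes `G(u) ⊗ v vᵀ`, with `v` the vector of monomials at `u`.
  have e : localizingMatrix G z k = ∑ u ∈ X, w u • kroneckerMap (· * ·) (G.map (eval u))
      (vecMulVec (fun α : monoPow σ ((2 * k - matDeg G) / 2) => ∏ j, u j ^ α.1 j)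
        (star fun α : monoPow σ ((2 * k - matDeg G) / 2) => ∏ j, u j ^ α.1 j)) := by
    ext p q
    have h1 := mem_monoPow.1 p.2.2
    have h2 := mem_monoPow.1 q.2.2
    simp only [localizingMatrix, of_apply, Matrix.sum_apply, Matrix.smul_apply, vecMulVec_apply,
      star_trivial, smul_eq_mul, kroneckerMap_apply, Matrix.map_apply]
    rw [h.riesz_eq (totalDegree_localizing_le G _ _ (s := (2 * k - matDeg G) / 2)
      (by rwa [totalDegree_monomial_one]) (by rwa [totalDegree_monomial_one]) (by omega))]
    simp only [map_mul, eval_monomial_one]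
  rw [e]
  exact posSemidef_sum _ fun u hu =>
    ((hX u hu).kronecker (posSemidef_vecMulVec_self_star _)).smul (hw u hu)

/-- A positive semidefinite localizing matrix of an atomic sequence forces `G(u) ⪰ 0` at every atom
`u` that is separated from the other atoms by a polynomial of low degree. -/
theorem IsAtomicUpTo.posSemidef_eval {l : ℕ} {G : Matrix (Fin l) (Fin l) (MvPolynomial σ ℝ)}
    (hsymm : G.IsSymm) {z : (σ →₀ ℕ) → ℝ} {k N s : ℕ} {X : Finset (σ → ℝ)} {w : (σ → ℝ) → ℝ}
    (h : IsAtomicUpTo z N X w) (hN : matDeg G + 2 * s ≤ N) (hs : s ≤ (2 * k - matDeg G) / 2)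
    (hL : (localizingMatrix G z k).PosSemidef) {u : σ → ℝ} (hu : u ∈ X) (hw : 0 < w u)
    {p : MvPolynomial σ ℝ} (hp : p.totalDegree ≤ s) (hpu : eval u p = 1)
    (hpX : ∀ u' ∈ X, u' ≠ u → eval u' p = 0) :
    (G.map (eval u)).PosSemidef := by
  refine Matrix.PosSemidef.of_dotProduct_mulVec_nonneg ?_ fun ξ => ?_
  · ext a b
    simp only [conjTranspose_apply, Matrix.map_apply, star_trivial]
    rw [← hsymm.apply a b]
  -- The factor `p²` removes every atom except `u`.
  have hr : ∀ a b, riesz z (G a b * (p * p)) = w u * eval u (G a b) := fun a b => by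
    rw [h.riesz_eq (totalDegree_localizing_le G a b hp hp hN), Finset.sum_eq_single u]
    · simp [hpu]
    · intro u' hu' hne
      simp [hpX u' hu' hne]
    · exact fun h => (h hu).elim
  have hpsum : p = ∑ α : monoPow σ ((2 * k - matDeg G) / 2),
      p.coeff α.1 • monomial α.1 (1 : ℝ) := by
    rw [Finset.sum_coe_sort (monoPow σ ((2 * k - matDeg G) / 2))
      (fun α => p.coeff α • monomial α (1 : ℝ))]
    conv_lhs => rw [← support_sum_monomial_coeff p]
    simp only [smul_monomial, smul_eq_mul, mul_one]
    refine Finset.sum_subset (fun α hα => mem_monoPow.2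
      ((degree_le_of_mem_support hα).trans (hp.trans hs))) fun α _ hα => ?_
    rw [notMem_support_iff.1 hα, monomial_zero]
  have hb : ∀ a b, riesz z (G a b * (p * p)) =
      ∑ α : monoPow σ ((2 * k - matDeg G) / 2), ∑ β : monoPow σ ((2 * k - matDeg G) / 2),
        p.coeff α.1 * p.coeff β.1 *
          riesz z (G a b * (monomial α.1 1 * monomial β.1 1)) := fun a b => by
    conv_lhs => rw [hpsum]
    simp only [Finset.sum_mul, Finset.mul_sum, riesz_eq_rieszLin, map_sum, smul_mul_assoc,
      mul_smul_comm, map_smul, smul_eq_mul]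
    rw [Finset.sum_comm]
    refine (Finset.sum_congr rfl fun α _ => Finset.sum_congr rfl fun β _ => ?_)
    ring
  -- The test vector is `ξ ⊗ coeff p`; its quadratic form is `w u · ξᵀ G(u) ξ`.
  have key := hL.dotProduct_mulVec_nonneg fun q => ξ q.1 * p.coeff q.2.1
  have e : star (fun q : Fin l × monoPow σ ((2 * k - matDeg G) / 2) => ξ q.1 * p.coeff q.2.1) ⬝ᵥ
      (localizingMatrix G z k *ᵥ fun q => ξ q.1 * p.coeff q.2.1) =
      w u * (star ξ ⬝ᵥ (G.map (eval u) *ᵥ ξ)) := by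
    have e1 : w u * (star ξ ⬝ᵥ (G.map (eval u) *ᵥ ξ)) =
        ∑ a, ∑ b, ξ a * ξ b * riesz z (G a b * (p * p)) := by
      simp only [dotProduct, mulVec, Finset.mul_sum, hr, Pi.star_apply, star_trivial,
        Matrix.map_apply]
      refine (Finset.sum_congr rfl fun α _ => Finset.sum_congr rfl fun β _ => ?_)
      ring
    rw [e1]
    simp only [hb, dotProduct, mulVec, Finset.mul_sum, Pi.star_apply, star_trivial,
      Fintype.sum_prod_type, localizingMatrix, of_apply]
    refine Finset.sum_congr rfl fun a _ => ?_
    rw [Finset.sum_comm]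
    refine Finset.sum_congr rfl fun b _ => Finset.sum_congr rfl fun α _ =>
      Finset.sum_congr rfl fun β _ => ?_
    ring
  rw [e] at key
  exact nonneg_of_mul_nonneg_right key hw

end Riesz

/-! ### Flat extension theorem via commuting multiplication operators -/

section FlatExtension

/-- A vector of a finite-dimensional real inner product space is a finite sum of nonzero, pairwise
orthogonal joint eigenvectors of any given commuting family of symmetric operators. -/
theorem exists_sum_joint_eigenvectors {σ H : Type*} [NormedAddCommGroup H] [InnerProductSpace ℝ H]
    [FiniteDimensional ℝ H] {T : σ → H →ₗ[ℝ] H} (hT : ∀ j, (T j).IsSymmetric)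
    (hC : ∀ i j, Commute (T i) (T j)) (v : H) :
    ∃ (X : Finset (σ → ℝ)) (e : (σ → ℝ) → H), (∀ u ∈ X, e u ≠ 0) ∧
      (∀ u j, T j (e u) = u j • e u) ∧ (∀ u u', u ≠ u' → inner ℝ (e u) (e u') = 0) ∧
      v = ∑ u ∈ X, e u := by
  have htop := LinearMap.IsSymmetric.iSup_iInf_eq_top_of_commute hT fun i j _ => hC i j
  have hv : v ∈ ⨆ χ : σ → ℝ, ⨅ i, Module.End.eigenspace (T i) (χ i) := by rw [htop]; trivial
  obtain ⟨f, hf, hfv⟩ := (Submodule.mem_iSup_iff_exists_finsupp _ _).1 hv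
  refine ⟨f.support, f, fun u hu => Finsupp.mem_support_iff.1 hu, fun u j => ?_,
    fun u u' hne => ?_, hfv.symm⟩
  · exact Module.End.mem_eigenspace_iff.1 ((Submodule.mem_iInf _).1 (hf u) j)
  · exact LinearMap.IsSymmetric.orthogonalFamily_iInf_eigenspaces hT hne ⟨f u, hf u⟩ ⟨f u', hf u'⟩

variable {σ : Type}

theorem exists_add_of_degree_le {α : σ →₀ ℕ} {t : ℕ} (h : α.degree ≤ 2 * t) :
    ∃ β γ : σ →₀ ℕ, β.degree ≤ t ∧ γ.degree ≤ t ∧ α = β + γ := by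
  obtain ⟨β, hβ, hd⟩ := Finsupp.exists_le_degree_eq α (min t α.degree) (min_le_right _ _)
  obtain ⟨γ, rfl⟩ := exists_add_of_le hβ
  rw [map_add] at h hd
  exact ⟨β, γ, by omega, by omega, rfl⟩

/-- If the vectors `a α` realize the moments of `z` up to degree `2 * t`, then the inner products of
their polynomial combinations are given by the Riesz functional. -/
theorem inner_constr {E : Type*} [NormedAddCommGroup E] [InnerProductSpace ℝ E]
    {z : (σ →₀ ℕ) → ℝ} {t : ℕ} {a : (σ →₀ ℕ) → E}
    (h : ∀ α β : σ →₀ ℕ, α.degree ≤ t → β.degree ≤ t → inner ℝ (a α) (a β) = z (α + β))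
    {p q : MvPolynomial σ ℝ} (hp : p.totalDegree ≤ t) (hq : q.totalDegree ≤ t) :
    inner ℝ ((basisMonomials σ ℝ).constr ℝ a p) ((basisMonomials σ ℝ).constr ℝ a q) =
      rieszLin z (p * q) := by
  set A := (basisMonomials σ ℝ).constr ℝ a with hA
  have hAm : ∀ α, A (monomial α 1) = a α := fun α => by
    rw [hA, constr_basisMonomials_monomial, one_smul]
  have h1 : ∀ α : σ →₀ ℕ, α.degree ≤ t →
      inner ℝ (a α) (A q) = rieszLin z (monomial α 1 * q) := fun α hα =>
    linearMap_congr (A := (innerₛₗ ℝ (a α)) ∘ₗ A)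
      (B := rieszLin z ∘ₗ LinearMap.mulLeft ℝ (monomial α 1)) hq fun β hβ => by
        simp [hAm, h α β hα hβ, rieszLin_monomial, monomial_mul]
  exact linearMap_congr (A := ((innerₛₗ ℝ).flip (A q)) ∘ₗ A)
    (B := rieszLin z ∘ₗ LinearMap.mulRight ℝ q) hp fun α hα => by
      simpa [hAm] using h1 α hα

variable [Fintype σ]

/-- A positive semidefinite moment matrix is a Gram matrix. -/
theorem exists_gram_momentMatrix {z : (σ →₀ ℕ) → ℝ} {t : ℕ} (h : (momentMatrix z t).PosSemidef) :
    ∃ a : (σ →₀ ℕ) → EuclideanSpace ℝ (monoPow σ t),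
      ∀ α β : σ →₀ ℕ, α.degree ≤ t → β.degree ≤ t → inner ℝ (a α) (a β) = z (α + β) := by
  classical
  -- Factor the moment matrix as `Bᴴ B`; the vector `a α` is the column of `B` at `α`.
  open scoped MatrixOrder Matrix.Norms.L2Operator in
  obtain ⟨B, hB⟩ := CStarAlgebra.nonneg_iff_eq_star_mul_self.mp h.nonneg
  refine ⟨fun α => if hα : α ∈ monoPow σ t then WithLp.toLp 2 fun i => B i ⟨α, hα⟩ else 0,
    fun α β hα hβ => ?_⟩
  have hα' := mem_monoPow.2 hα
  have hβ' := mem_monoPow.2 hβ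
  have e := congrFun (congrFun hB ⟨α, hα'⟩) ⟨β, hβ'⟩
  simp only [momentMatrix, of_apply] at e
  rw [e]
  simp [hα', hβ', PiLp.inner_apply, Matrix.mul_apply, star_eq_conjTranspose, mul_comm]

/-- The rank of a moment matrix that is the Gram matrix of vectors `a α`. -/
theorem rank_momentMatrix {E : Type*} [NormedAddCommGroup E] [InnerProductSpace ℝ E]
    [FiniteDimensional ℝ E] {z : (σ →₀ ℕ) → ℝ} {s : ℕ} {a : (σ →₀ ℕ) → E}
    (h : ∀ α β : σ →₀ ℕ, α.degree ≤ s → β.degree ≤ s → inner ℝ (a α) (a β) = z (α + β)) :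
    (momentMatrix z s).rank = Module.finrank ℝ
      (Submodule.span ℝ (Set.range fun α : monoPow σ s => a α.1)) := by
  have e : momentMatrix z s = gram ℝ fun α : monoPow σ s => a α.1 := by
    ext α β
    rw [gram_apply, h _ _ (mem_monoPow.1 α.2) (mem_monoPow.1 β.2)]
    rfl
  rw [e, gram_eq_conjTranspose_mul (stdOrthonormalBasis ℝ E), rank_conjTranspose_mul_self,
    rank_eq_finrank_span_cols]
  let L : E ≃ₗ[ℝ] (Fin (Module.finrank ℝ E) → ℝ) :=
    (stdOrthonormalBasis ℝ E).toBasis.equivFun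
  rw [← LinearEquiv.finrank_map_eq L, Submodule.map_span, ← Set.range_comp]
  congr 1

theorem restrictTotalDegree_eq_span (s : ℕ) :
    restrictTotalDegree σ ℝ s =
      Submodule.span ℝ (Set.range fun α : monoPow σ s => monomial α.1 (1 : ℝ)) := by
  apply le_antisymm
  · intro p hp
    rw [mem_restrictTotalDegree] at hp
    rw [← support_sum_monomial_coeff p]
    refine Submodule.sum_mem _ fun α hα => ?_
    rw [← mul_one (coeff α p), ← smul_eq_mul, ← smul_monomial]
    exact Submodule.smul_mem _ _ (Submodule.subset_span
      ⟨⟨α, mem_monoPow.2 ((degree_le_of_mem_support hα).trans hp)⟩, rfl⟩)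
  · rw [Submodule.span_le]
    rintro _ ⟨α, rfl⟩
    rw [SetLike.mem_coe, mem_restrictTotalDegree, totalDegree_monomial_one]
    exact mem_monoPow.1 α.2

/-- The flat extension theorem: if the moment matrix of order `t` is positive semidefinite and has
the rank of its leading block of order `s < t`, then the sequence is atomic up to degree `2 * t`
with `rank` many atoms, which are separated by polynomials of degree at most `s`. -/
theorem exists_atoms_of_flat {z : (σ →₀ ℕ) → ℝ} {s t : ℕ} (hst : s < t)
    (hM : (momentMatrix z t).PosSemidef)
    (hrank : (momentMatrix z t).rank = (momentMatrix z s).rank) :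
    ∃ (X : Finset (σ → ℝ)) (w : (σ → ℝ) → ℝ), X.card = (momentMatrix z t).rank ∧
      (∀ u ∈ X, 0 < w u) ∧ IsAtomicUpTo z (2 * t) X w ∧
      ∀ u ∈ X, ∃ p : MvPolynomial σ ℝ, p.totalDegree ≤ s ∧ eval u p = 1 ∧
        ∀ u' ∈ X, u' ≠ u → eval u' p = 0 := by
  obtain ⟨a, ha⟩ := exists_gram_momentMatrix hM
  have hin := fun p q => inner_constr ha (p := p) (q := q)
  set A := (basisMonomials σ ℝ).constr ℝ a with hA
  have hAm : ∀ α, A (monomial α 1) = a α := fun α => by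
    rw [hA, constr_basisMonomials_monomial, one_smul]
  have hmap : ∀ r, (restrictTotalDegree σ ℝ r).map A =
      Submodule.span ℝ (Set.range fun α : monoPow σ r => a α.1) := fun r => by
    rw [restrictTotalDegree_eq_span, Submodule.map_span, ← Set.range_comp]
    simp only [Function.comp_def, hAm]
  have hmono : ∀ {r r'}, r ≤ r' → restrictTotalDegree σ ℝ r ≤ restrictTotalDegree σ ℝ r' :=
    fun hr p hp => by
      rw [mem_restrictTotalDegree] at hp ⊢
      exact hp.trans hr
  set H := (restrictTotalDegree σ ℝ t).map A
  have hfr : Module.finrank ℝ H = (momentMatrix z t).rank := by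
    rw [rank_momentMatrix ha, ← hmap]
  -- Equal ranks are equal dimensions, so the inclusion of spans is an equality.
  have hHs : (restrictTotalDegree σ ℝ s).map A = H := by
    refine Submodule.eq_of_le_of_finrank_eq (Submodule.map_mono (hmono hst.le)) ?_
    rw [hfr, hrank, hmap, rank_momentMatrix fun α β hα hβ => ha α β (hα.trans hst.le)
      (hβ.trans hst.le)]
  have hsurj : ∀ h : H, ∃ p : MvPolynomial σ ℝ, p.totalDegree ≤ s ∧ A p = h := fun h => by
    have hh : (h : EuclideanSpace ℝ (monoPow σ t)) ∈ (restrictTotalDegree σ ℝ s).map A := by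
      rw [hHs]; exact h.2
    obtain ⟨p, hp, hph⟩ := hh
    exact ⟨p, (mem_restrictTotalDegree _ _ _).1 hp, hph⟩
  have hAH : ∀ {p : MvPolynomial σ ℝ}, p.totalDegree ≤ t → A p ∈ H := fun hp =>
    Submodule.mem_map_of_mem ((mem_restrictTotalDegree _ _ _).2 hp)
  have hX : ∀ {p : MvPolynomial σ ℝ} (j : σ), p.totalDegree ≤ s →
      (X j * p).totalDegree ≤ s + 1 := fun {p} j hp => by
    have := totalDegree_mul (X j) p
    rw [totalDegree_X] at this
    omega
  have hHinj : ∀ {q r : MvPolynomial σ ℝ}, q.totalDegree ≤ t → r.totalDegree ≤ t →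
      (∀ p : MvPolynomial σ ℝ, p.totalDegree ≤ s → rieszLin z (q * p) = rieszLin z (r * p)) →
      A q = A r := fun {q r} hq hr hqr => by
    rw [← sub_eq_zero, ← map_sub]
    have hqr' : (q - r).totalDegree ≤ t := (totalDegree_sub q r).trans (max_le hq hr)
    obtain ⟨p, hp, hpe⟩ := hsurj ⟨A (q - r), hAH hqr'⟩
    change A p = A (q - r) at hpe
    rw [← inner_self_eq_zero (𝕜 := ℝ)]
    nth_rw 2 [← hpe]
    rw [hin _ _ hqr' (hp.trans hst.le), sub_mul, map_sub, hqr p hp, sub_self]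
  -- The class of `X j * p` depends only on that of `p`: against a test `r` of degree at most `s`,
  -- the variable moves over to `r`, and `X j * r` has degree at most `s + 1 ≤ t`. This is where `s
  -- < t` is needed.
  have hker : ∀ {p q : MvPolynomial σ ℝ} (j : σ), p.totalDegree ≤ s → q.totalDegree ≤ t →
      (X j * q).totalDegree ≤ t → A p = A q → A (X j * p) = A (X j * q) :=
    fun {p q} j hp hq hjq hpq => by
      refine hHinj ((hX j hp).trans hst) hjq fun r hr => ?_
      rw [mul_assoc, mul_left_comm, ← hin _ _ (hp.trans hst.le) ((hX j hr).trans hst), hpq,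
        hin _ _ hq ((hX j hr).trans hst), mul_assoc, mul_left_comm]
  let Φ : restrictTotalDegree σ ℝ s →ₗ[ℝ] H :=
    (A.domRestrict (restrictTotalDegree σ ℝ s)).codRestrict H
    fun p => hAH (((mem_restrictTotalDegree _ _ _).1 p.2).trans hst.le)
  -- `S` chooses linearly a representative of degree at most `s`, so that multiplying it by a
  -- variable stays within degree `t`.
  obtain ⟨S, hS⟩ := Φ.exists_rightInverse_of_surjective (LinearMap.range_eq_top.2 fun h => by
    obtain ⟨p, hp, hph⟩ := hsurj h
    exact ⟨⟨p, (mem_restrictTotalDegree _ _ _).2 hp⟩, Subtype.ext hph⟩)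
  have hSdeg : ∀ h : H, (S h : MvPolynomial σ ℝ).totalDegree ≤ s := fun h =>
    (mem_restrictTotalDegree _ _ _).1 (S h).2
  have hSA : ∀ h : H, A (S h : MvPolynomial σ ℝ) = h := fun h =>
    congrArg Subtype.val (LinearMap.congr_fun hS h)
  let T : σ → H →ₗ[ℝ] H := fun j =>
    (A ∘ₗ LinearMap.mulLeft ℝ (X j) ∘ₗ (restrictTotalDegree σ ℝ s).subtype ∘ₗ S).codRestrict H
      fun h => hAH ((hX j (hSdeg h)).trans hst)
  have hT0 : ∀ j h, (T j h : EuclideanSpace ℝ (monoPow σ t)) = A (X j * (S h : MvPolynomial σ ℝ)) := fun _ _ => rfl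
  have hT : ∀ (j : σ) (h : H) (q : MvPolynomial σ ℝ), q.totalDegree ≤ t →
      (X j * q).totalDegree ≤ t → A q = h →
      (T j h : EuclideanSpace ℝ (monoPow σ t)) = A (X j * q) := fun j h q hq hjq hqh => by
    rw [hT0]
    exact hker j (hSdeg h) hq hjq ((hSA h).trans hqh.symm)
  have hTin : ∀ (j : σ) (h g : H), inner ℝ (T j h) g =
      rieszLin z (X j * (S h : MvPolynomial σ ℝ) * (S g : MvPolynomial σ ℝ)) := fun j h g => by
    rw [Submodule.coe_inner, hT0]
    have := hin _ _ ((hX j (hSdeg h)).trans hst) ((hSdeg g).trans hst.le)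
    rwa [hSA] at this
  have hTsymm : ∀ j, (T j).IsSymmetric := fun j h g => by
    rw [real_inner_comm (T j g) h, hTin, hTin]
    congr 1
    ring
  have hTcomm : ∀ i j, Commute (T i) (T j) := fun i j => by
    refine LinearMap.ext fun h => ext_inner_right ℝ fun g => ?_
    change inner ℝ (T i (T j h)) g = inner ℝ (T j (T i h)) g
    -- Degree `s + 2` may exceed `t`, so the two variables are never multiplied onto one
    -- representative: symmetry moves the outer operator to the other argument.
    rw [hTsymm i (T j h) g, hTsymm j (T i h) g, Submodule.coe_inner, Submodule.coe_inner]
    simp only [hT0]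
    rw [hin _ _ ((hX j (hSdeg h)).trans hst) ((hX i (hSdeg g)).trans hst),
      hin _ _ ((hX i (hSdeg h)).trans hst) ((hX j (hSdeg g)).trans hst)]
    congr 1
    ring
  obtain ⟨X₀, e, he0, heT, hort, hsum⟩ := exists_sum_joint_eigenvectors hTsymm hTcomm
    ⟨A 1, hAH (by simp)⟩
  -- Induction on the degree: each variable acts on `e u` as the scalar `u j`, so `A` sends a
  -- monomial to the sum of its values at the atoms times `e u`.
  have hmon : ∀ (n : ℕ) (α : σ →₀ ℕ), α.degree = n → n ≤ t →
      A (monomial α 1) = (↑(∑ u ∈ X₀, eval u (monomial α 1) • e u) : EuclideanSpace ℝ _) := by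
    intro n
    induction n with
    | zero =>
      intro α hα _
      obtain rfl : α = 0 := (Finsupp.degree_eq_zero_iff α).1 hα
      simpa [← C_apply] using congrArg Subtype.val hsum
    | succ n ih =>
      intro α hα hn
      obtain ⟨j, hj⟩ : ∃ j, α j ≠ 0 := by
        by_contra! hcon
        obtain rfl : α = 0 := Finsupp.ext hcon
        simp at hα
      have hle : Finsupp.single j 1 ≤ α :=
        Finsupp.single_le_iff.2 (Nat.one_le_iff_ne_zero.2 hj)
      obtain ⟨β, rfl⟩ := exists_add_of_le hle
      have hβ : β.degree = n := by
        rw [map_add, Finsupp.degree_single] at hα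
        omega
      have hmul : monomial (Finsupp.single j 1 + β) (1 : ℝ) = X j * monomial β 1 := by
        rw [X, monomial_mul, one_mul]
      rw [hmul, ← hT j _ _ (by rw [totalDegree_monomial_one]; omega)
        (by rw [← hmul, totalDegree_monomial_one]; omega) (ih β hβ (by omega)), map_sum]
      congr 1
      refine Finset.sum_congr rfl fun u _ => ?_
      rw [map_smul, heT, smul_smul, map_mul, eval_X, mul_comm]
  have hAeval : ∀ p : MvPolynomial σ ℝ, p.totalDegree ≤ t →
      A p = (↑(∑ u ∈ X₀, eval u p • e u) : EuclideanSpace ℝ _) := fun p hp => by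
    have := linearMap_congr (A := A) (B := H.subtype ∘ₗ
      ∑ u ∈ X₀, (aeval u : MvPolynomial σ ℝ →ₐ[ℝ] ℝ).toLinearMap.smulRight (e u)) hp
      fun α hα => by
        rw [hmon _ α rfl hα]
        simp [aeval_eq_eval]
    rw [this]
    simp [aeval_eq_eval]
  have hcoef : ∀ (p : MvPolynomial σ ℝ), p.totalDegree ≤ t → ∀ u ∈ X₀,
      inner ℝ (A p) (e u : EuclideanSpace ℝ (monoPow σ t)) = eval u p * ‖e u‖ ^ 2 :=
    fun p hp u hu => by
      rw [hAeval p hp, ← Submodule.coe_inner, sum_inner, Finset.sum_eq_single u]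
      · rw [real_inner_smul_left, real_inner_self_eq_norm_sq]
      · intro u' _ hne
        rw [real_inner_smul_left, hort _ _ hne, mul_zero]
      · exact fun h => (h hu).elim
  refine ⟨X₀, fun u => ‖e u‖ ^ 2, ?_, fun u hu => pow_pos (norm_pos_iff.2 (he0 u hu)) 2, ?_, ?_⟩
  · rw [← hfr]
    -- The `e u` form a basis of `H`: they are orthogonal and nonzero, and every element of `H` is
    -- some `A p`, hence a combination of them.
    have hli : LinearIndependent ℝ fun u : X₀ => e u.1 :=
      linearIndependent_of_ne_zero_of_inner_eq_zero (fun u => he0 _ u.2) fun u u' hne =>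
        hort _ _ fun h => hne (Subtype.ext h)
    have hspan : ⊤ ≤ Submodule.span ℝ (Set.range fun u : X₀ => e u.1) := fun h _ => by
      obtain ⟨p, hp, hph⟩ := hsurj h
      rw [hAeval p (hp.trans hst.le)] at hph
      rw [← Subtype.ext hph]
      exact Submodule.sum_mem _ fun u hu =>
        Submodule.smul_mem _ _ (Submodule.subset_span ⟨⟨u, hu⟩, rfl⟩)
    rw [Module.finrank_eq_card_basis (Module.Basis.mk hli hspan), Fintype.card_coe]
  · intro α hα
    obtain ⟨β, γ, hβ, hγ, rfl⟩ := exists_add_of_degree_le hα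
    rw [← ha β γ hβ hγ, ← hAm γ, hmon _ γ rfl hγ, Submodule.coe_sum, inner_sum]
    refine Finset.sum_congr rfl fun u hu => ?_
    rw [Submodule.coe_smul, real_inner_smul_right, ← hAm,
      hcoef _ (by rwa [totalDegree_monomial_one]) u hu, ← eval_monomial_one]
    have hmul : monomial (β + γ) (1 : ℝ) = monomial β 1 * monomial γ 1 := by
      rw [monomial_mul, one_mul]
    rw [hmul, map_mul]
    ring
  · intro u hu
    -- A preimage of `e u` of degree at most `s` separates: pairing `A p = e u` with `e u'` gives
    -- `p(u') ‖e u'‖² = ⟨e u, e u'⟩`.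
    obtain ⟨p, hp, hpu⟩ := hsurj (e u)
    have hne : ∀ u' ∈ X₀, ‖e u'‖ ^ 2 ≠ 0 := fun u' hu' =>
      pow_ne_zero 2 (norm_ne_zero_iff.2 (he0 u' hu'))
    refine ⟨p, hp, ?_, fun u' hu' huu' => ?_⟩
    · have := hcoef p (hp.trans hst.le) u hu
      rw [hpu, ← Submodule.coe_inner, real_inner_self_eq_norm_sq] at this
      exact mul_right_cancel₀ (hne u hu) (by rw [one_mul, ← this])
    · have := hcoef p (hp.trans hst.le) u' hu'
      rw [hpu, ← Submodule.coe_inner, hort _ _ huu'.symm] at this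
      exact (mul_eq_zero.1 this.symm).resolve_right (hne u' hu')

end FlatExtension

/-! ### The sparse moment relaxation and splitting off a Dirac sequence -/

namespace SparseMatPOP

variable {n m : ℕ} (P : SparseMatPOP n m)

theorem riesz_rename {σ τ : Type} (g : σ → τ) (z : (τ →₀ ℕ) → ℝ) (p : MvPolynomial σ ℝ) :
    riesz (fun α => z (α.mapDomain g)) p = riesz z (rename g p) := by
  rw [riesz_eq_rieszLin, riesz_eq_rieszLin]
  exact linearMap_congr (B := rieszLin z ∘ₗ (rename g).toLinearMap) le_rfl fun α _ => by
    simp [rieszLin_monomial, rename_monomial]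

theorem pairing_eq_riesz {k : ℕ} (y : P.TMS k) : P.pairing y = riesz (P.entry y) P.obj := by
  simp only [pairing, obj, incl, riesz_eq_rieszLin, map_sum]
  refine Finset.sum_congr rfl fun i _ => ?_
  rw [← riesz_eq_rieszLin, ← riesz_eq_rieszLin]
  exact riesz_rename _ _ _

/-- With the degree bound on `f`, this places every monomial of `f` in `𝕌_k`, so that truncation
does not alter `⟨f, ·⟩`. -/
theorem exists_of_mem_support_obj {α : Fin n →₀ ℕ} (h : α ∈ P.obj.support) :
    ∃ i, ∀ j, j ∉ P.Δ i → α j = 0 := by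
  classical
  rw [mem_support_iff, obj, coeff_sum] at h
  obtain ⟨i, -, hi⟩ := Finset.exists_ne_zero_of_sum_ne_zero h
  rw [← mem_support_iff, incl, support_rename_of_injective Subtype.val_injective] at hi
  obtain ⟨β, -, rfl⟩ := Finset.mem_image.1 hi
  refine ⟨i, fun j hj => Finsupp.mapDomain_of_notMem_range _ _ ?_⟩
  rintro ⟨j', rfl⟩
  exact hj j'.2

theorem mapDomain_mem_U {k : ℕ} {i : Fin m} {α : P.Δ i →₀ ℕ} (h : α.degree ≤ 2 * k) :
    α.mapDomain Subtype.val ∈ P.U k := by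
  refine ⟨i, fun j hj => Finsupp.mapDomain_of_notMem_range _ _ ?_, by rwa [Finsupp.degree_mapDomain]⟩
  rintro ⟨j', rfl⟩
  exact hj j'.2

/-- The truncation of a full multi-sequence. -/
def trunc (z : (Fin n →₀ ℕ) → ℝ) (k : ℕ) : P.TMS k := fun α => z α.1

theorem entry_trunc {z : (Fin n →₀ ℕ) → ℝ} {k : ℕ} {α : Fin n →₀ ℕ} (h : α ∈ P.U k) :
    P.entry (P.trunc z k) α = z α := dif_pos h

theorem sub_trunc {z : (Fin n →₀ ℕ) → ℝ} {k : ℕ} {i : Fin m} {α : P.Δ i →₀ ℕ}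
    (h : α.degree ≤ 2 * k) : P.sub (P.trunc z k) i α = z (α.mapDomain Subtype.val) :=
  P.entry_trunc (P.mapDomain_mem_U h)

theorem totalDegree_obj_le {k : ℕ} (hk : P.k₀ ≤ k) : P.obj.totalDegree ≤ 2 * k := by
  have := (le_max_left _ _).trans hk
  simp only [ceilHalf] at this
  omega

theorem d_le {k : ℕ} (hk : P.k₀ ≤ k) (i : Fin m) : P.d i ≤ k :=
  (Finset.le_sup (f := P.d) (Finset.mem_univ i)).trans ((le_max_right _ _).trans hk)

theorem matDeg_le {k : ℕ} (hk : P.k₀ ≤ k) (i : Fin m) : matDeg (P.G i) ≤ 2 * k := by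
  have := P.d_le hk i
  simp only [d, ceilHalf] at this
  omega

theorem pairing_trunc {k : ℕ} (hk : P.k₀ ≤ k) (z : (Fin n →₀ ℕ) → ℝ) :
    P.pairing (P.trunc z k) = riesz z P.obj := by
  rw [pairing_eq_riesz]
  refine Finset.sum_congr rfl fun α hα => ?_
  obtain ⟨i, hi⟩ := P.exists_of_mem_support_obj hα
  rw [P.entry_trunc ⟨i, hi, (degree_le_of_mem_support hα).trans (P.totalDegree_obj_le hk)⟩]

/-- Each block may have its own measure; agreement on overlaps is built in, since all blocks read
the same `y`. -/
theorem mem_momFeasible_of_isAtomicUpTo {k : ℕ} (hk : P.k₀ ≤ k) {y : P.TMS k}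
    (h0 : P.entry y 0 = 1) {X : (i : Fin m) → Finset (P.Δ i → ℝ)}
    {w : (i : Fin m) → (P.Δ i → ℝ) → ℝ} (hX : ∀ i, ∀ u ∈ X i, u ∈ P.KΔ i)
    (hw : ∀ i, ∀ u ∈ X i, 0 ≤ w i u)
    (hy : ∀ i, IsAtomicUpTo (P.sub y i) (2 * k) (X i) (w i)) : y ∈ P.momFeasible k :=
  ⟨fun i => (hy i).posSemidef_localizingMatrix (P.matDeg_le hk i) (hw i) (hX i),
    fun i => (hy i).posSemidef_momentMatrix (hw i), h0⟩

/-- The full moment sequence of the Dirac measure at `x`. -/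
def diracSeq (x : Fin n → ℝ) : (Fin n →₀ ℕ) → ℝ := fun α => ∏ j, x j ^ α j

theorem diracSeq_mapDomain (x : Fin n → ℝ) (i : Fin m) (α : P.Δ i →₀ ℕ) :
    diracSeq x (α.mapDomain Subtype.val) = ∏ j, P.subvec i x j ^ α j := by
  rw [diracSeq, ← eval_monomial_one, ← eval_monomial_one, ← rename_monomial, eval_rename]
  rfl

theorem riesz_diracSeq (x : Fin n → ℝ) (p : MvPolynomial (Fin n) ℝ) :
    riesz (diracSeq x) p = eval x p := by
  have h : IsAtomicUpTo (diracSeq x) p.totalDegree {x} 1 := fun α _ => by simp [diracSeq]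
  simpa using h.riesz_eq le_rfl

theorem trunc_diracSeq_mem_momFeasible {k : ℕ} (hk : P.k₀ ≤ k) (hm : 0 ∈ P.U k) {x : Fin n → ℝ}
    (hx : x ∈ P.K) : P.trunc (diracSeq x) k ∈ P.momFeasible k :=
  P.mem_momFeasible_of_isAtomicUpTo hk (by rw [P.entry_trunc hm]; simp [diracSeq])
    (X := fun i => {P.subvec i x}) (w := 1)
    (fun i u hu => by rw [Finset.mem_singleton.1 hu]; exact hx i)
    (fun i u _ => zero_le_one) fun i α hα => by
      rw [P.sub_trunc hα, diracSeq_mapDomain]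
      simp

theorem IsMomMinimizer.fsmo_eq {P : SparseMatPOP n m} {k : ℕ} {y : P.TMS k}
    (hy : P.IsMomMinimizer y) : P.fsmo k = (P.pairing y : ℝ) :=
  le_antisymm (sInf_le ⟨y, hy.1, rfl⟩) (le_sInf (by
    rintro _ ⟨y', hy', rfl⟩
    exact EReal.coe_le_coe_iff.2 (hy.2 y' hy')))

theorem IsMinimizer.fmin_eq {P : SparseMatPOP n m} {x : Fin n → ℝ} (hx : P.IsMinimizer x) :
    P.fmin = (eval x P.obj : ℝ) :=
  le_antisymm (sInf_le ⟨x, hx.1, rfl⟩) (le_sInf (by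
    rintro _ ⟨x', hx', rfl⟩
    exact EReal.coe_le_coe_iff.2 (hx.2 x' hx')))

/-- Only `m = 0` has to be excluded: then `𝕌_k` is empty and the entry at `0` takes the default
value `0`, not `1`. -/
theorem zero_mem_U {k : ℕ} {y : P.TMS k} (h : P.entry y 0 = 1) (t : ℕ) : 0 ∈ P.U t := by
  have hk : (0 : Fin n →₀ ℕ) ∈ P.U k := by
    by_contra hcon
    rw [entry, dif_neg hcon] at h
    exact zero_ne_one h
  obtain ⟨i, -, -⟩ := hk
  exact ⟨i, fun _ _ => rfl, by simp⟩

theorem sub_zero_eq {k : ℕ} (y : P.TMS k) (i : Fin m) : P.sub y i 0 = P.entry y 0 := by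
  rw [sub, Finsupp.mapDomain_zero]

theorem exists_isAtomSet {k t : ℕ} (ht : P.k₀ ≤ t) (htk : t ≤ k) {y : P.TMS k}
    (hy : y ∈ P.momFeasible k) (hflat : P.FlatTruncation y t) {i : Fin m}
    (hG : 1 ≤ matDeg (P.G i)) : ∃ X, P.IsAtomSet y t i X := by
  obtain ⟨hL, hM, h0⟩ := hy
  have hMt : (momentMatrix (P.sub y i) t).PosSemidef :=
    (hM i).submatrix fun α : monoPow (P.Δ i) t =>
      (⟨α.1, mem_monoPow.2 ((mem_monoPow.1 α.2).trans htk)⟩ : monoPow (P.Δ i) k)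
  have hd := P.d_le ht i
  have hd' : P.d i = (matDeg (P.G i) + 1) / 2 := rfl
  -- Positive degree of `G_i` gives `d_i ≥ 1`, hence `t - d_i < t`.
  obtain ⟨X, w, hcard, hw, hat, hsep⟩ :=
    exists_atoms_of_flat (s := t - P.d i) (by omega) hMt (hflat i)
  refine ⟨X, hcard, fun u hu => ?_, w, hw, ?_, fun α hα => hat α (mem_monoPow.1 hα)⟩
  · obtain ⟨p, hp, hpu, hpX⟩ := hsep u hu
    exact hat.posSemidef_eval (P.symm i) (by omega) (by omega) (hL i) hu (hw u hu) hp hpu hpX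
  · have := hat 0 (by simp)
    rw [sub_zero_eq, h0] at this
    simpa using this.symm

/-- A point whose subvectors are all atoms of the minimizer attains the optimal value of the
relaxation: its moment sequence can be split off from the minimizer as a convex summand. -/
theorem eval_obj_le_pairing {k t : ℕ} (ht : P.k₀ ≤ t) {y : P.TMS k}
    (h0 : P.entry y 0 = 1) (hmin : ∀ y' ∈ P.momFeasible t, P.pairing y ≤ P.pairing y')
    {X : (i : Fin m) → Finset (P.Δ i → ℝ)} (hX : ∀ i, P.IsAtomSet y t i (X i))
    {x : Fin n → ℝ} (hx : ∀ i, P.subvec i x ∈ X i) : eval x P.obj ≤ P.pairing y := by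
  classical
  choose _ hXK w hw hw1 hyw using hX
  -- Strictness `ε < 1` is imposed separately: a block with a single atom has weight `1`.
  obtain ⟨ε, hε⟩ : ∃ ε : ℝ, 0 < ε ∧ ε < 1 ∧ ∀ i, ε ≤ w i (P.subvec i x) := by
    have h1 : ∀ᶠ ε in nhdsWithin (0 : ℝ) (Set.Ioi 0), 0 < ε ∧ ε < 1 :=
      Ioo_mem_nhdsGT zero_lt_one
    have h2 : ∀ᶠ ε in nhdsWithin (0 : ℝ) (Set.Ioi 0), ∀ i, ε ≤ w i (P.subvec i x) :=
      Filter.eventually_all.2 fun i =>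
        (Filter.mem_of_superset (Ioc_mem_nhdsGT (hw i _ (hx i))) fun _ h => h.2)
    obtain ⟨ε, h⟩ := (h1.and h2).exists
    exact ⟨ε, h.1.1, h.1.2, h.2⟩
  obtain ⟨hε0, hε1, hεw⟩ := hε
  have hpos : 0 < 1 - ε := sub_pos.2 hε1
  have h0t := P.zero_mem_U h0 t
  let z : (Fin n →₀ ℕ) → ℝ := fun α => (1 - ε)⁻¹ * (P.entry y α - ε * diracSeq x α)
  have hz : P.trunc z t ∈ P.momFeasible t := by
    refine P.mem_momFeasible_of_isAtomicUpTo ht ?_ hXK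
      (w := fun i u => (1 - ε)⁻¹ * (w i u - if u = P.subvec i x then ε else 0))
      (fun i u hu => mul_nonneg (inv_nonneg.2 hpos.le) ?_) fun i α hα => ?_
    · rw [P.entry_trunc h0t]
      simp only [z, h0, diracSeq, Finsupp.coe_zero, Pi.zero_apply, pow_zero,
        Finset.prod_const_one, mul_one]
      exact inv_mul_cancel₀ hpos.ne'
    · split_ifs with h
      · rw [h]; exact sub_nonneg.2 (hεw i)
      · rw [_root_.sub_zero]; exact (hw i u hu).le
    · rw [P.sub_trunc hα]
      have e := hyw i α (mem_monoPow.2 hα)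
      rw [sub] at e
      simp only [z, e, diracSeq_mapDomain, mul_assoc, ← Finset.mul_sum, sub_mul,
        Finset.sum_sub_distrib, ite_mul, zero_mul, Finset.sum_ite_eq', if_pos (hx i)]
  have key := hmin _ hz
  rw [P.pairing_trunc ht] at key
  have e : riesz z P.obj = (1 - ε)⁻¹ * (P.pairing y - ε * eval x P.obj) := by
    rw [pairing_eq_riesz, ← riesz_diracSeq]
    simp only [riesz, z, Finset.mul_sum, ← Finset.sum_sub_distrib]
    exact Finset.sum_congr rfl fun α _ => by ring
  rw [e, le_inv_mul_iff₀ hpos] at key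
  -- Here `(1 - ε)⟨f, y⟩ ≤ ⟨f, y⟩ - ε f(x)`, and `ε > 0` can be cancelled.
  nlinarith

end SparseMatPOP

end

theorem theorem4p1 {n m : ℕ} (P : SparseMatPOP n m) (k t : ℕ)
    (ht : P.k₀ ≤ t) (htk : t ≤ k)
    (y : P.TMS k) (hy : P.IsMomMinimizer y)
    (hflat : P.FlatTruncation y t) (hval : P.fsmo t = P.fsmo k) :
    (∀ i, 1 ≤ matDeg (P.G i) → ∃ X, P.IsAtomSet y t i X) ∧
    ∀ X : (i : Fin m) → Finset (P.Δ i → ℝ), (∀ i, P.IsAtomSet y t i (X i)) →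
      ∀ x : Fin n → ℝ, (∀ i, P.subvec i x ∈ X i) →
        P.fmin = P.fsmo k ∧ P.IsMinimizer x ∧
        (P.fspa k = P.fsmo k → P.fmin = P.fspa k) := by
  refine ⟨fun i hG => P.exists_isAtomSet ht htk hy.1 hflat hG, fun X hX x hx => ?_⟩
  have h0 := hy.1.2.2
  have hK : x ∈ P.K := fun i => (hX i).2.1 _ (hx i)
  have hle : MvPolynomial.eval x P.obj ≤ P.pairing y :=
    -- Equality of the values of orders `t` and `k` lets `y`, a minimizer at order `k`, compete with
    -- all feasible points of order `t`.
    P.eval_obj_le_pairing ht h0 (fun y' hy' => by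
      rw [← EReal.coe_le_coe_iff, ← hy.fsmo_eq, ← hval]
      exact sInf_le ⟨y', hy', rfl⟩) hX hx
  have hge : ∀ x' ∈ P.K, P.pairing y ≤ MvPolynomial.eval x' P.obj := fun x' hx' => by
    have := hy.2 _ (P.trunc_diracSeq_mem_momFeasible (ht.trans htk) (P.zero_mem_U h0 k) hx')
    rwa [P.pairing_trunc (ht.trans htk), SparseMatPOP.riesz_diracSeq] at this
  have hmin : P.IsMinimizer x := ⟨hK, fun x' hx' => hle.trans (hge x' hx')⟩
  have hf : P.fmin = P.fsmo k := by
    rw [hmin.fmin_eq, hy.fsmo_eq, hle.antisymm (hge x hK)]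
  exact ⟨hf, hmin, fun hgap => hf.trans hgap.symm⟩
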